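/- Let $q$ and $a$ be complex numbers with $|q|<1$ and $a\neq0$, such that $aq^{6j}\neq1$ and $q^{6j}/a\neq1$ for all integers $j\ge1$. Write $(x;p)_k=\prod_{j=0}^{k-1}(1-xp^j)$ for $k=0,1,2,\dots$, $(x;p)_\infty=\prod_{j=0}^{\infty}(1-xp^j)$ for $|p|<1$, and $[n]=\dfrac{1-q^n}{1-q}$. Then the series on the left-hand side below converges absolutely and $$ \sum_{k=0}^\infty\frac{(aq;q^2)_k\,(q/a;q^2)_k\,(q;q^2)_{2k}}{(q^2;q^2)_{2k}\,(aq^6;q^6)_k\,(q^6/a;q^6)_k}\,[8k+1]\,q^{2k^2} =\frac{(q^5;q^6)_\infty\,(q^7;q^6)_\infty\,(aq^3;q^6)_\infty\,(q^3/a;q^6)_\infty} {(q^2;q^6)_\infty\,(q^4;q^6)_\infty\,(aq^6;q^6)_\infty\,(q^6/a;q^6)_\infty}. $$ -/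

import Mathlib

/-- The finite `q`-Pochhammer symbol `(a; q)_k = ∏_{j=0}^{k-1} (1 - a q^j)`. -/
noncomputable def qPoch (a q : ℂ) (k : ℕ) : ℂ :=
  ∏ j ∈ Finset.range k, (1 - a * q ^ j)

/-- The infinite `q`-Pochhammer symbol `(a; q)_∞ = ∏_{j ≥ 0} (1 - a q^j)`, used for `|q| < 1`. -/
noncomputable def qPochInf (a q : ℂ) : ℂ :=
  ∏' j : ℕ, (1 - a * q ^ j)

/-- For `|q| < 1` the infinite product converges, so `qPochInf` is its genuine value. -/
theorem hasProd_qPochInf (a q : ℂ) (hq : ‖q‖ < 1) :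
    HasProd (fun j : ℕ => 1 - a * q ^ j) (qPochInf a q) := by
  have h : Summable fun j : ℕ => ‖-(a * q ^ j)‖ := by
    simp only [norm_neg, norm_mul, norm_pow]
    exact (summable_geometric_of_lt_one (norm_nonneg q) hq).mul_left _
  have h2 := (multipliable_one_add_of_summable h).hasProd
  simpa only [← sub_eq_add_neg, qPochInf] using h2

/-- The `q`-number `[n] = (1 - q^n) / (1 - q)`, used for `q ≠ 1`. -/
noncomputable def qNumber (q : ℂ) (n : ℕ) : ℂ :=
  (1 - q ^ n) / (1 - q)

open Filter Topology

/-! Put `p = q^2`, `b = aq`, `d = q/a`, so `bd = p`, and replace the remaining `q` by a free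
parameter `A`. With denominators in `A` cleared, let `F(A) = ∑ cubicTerm p b d A k`. A WZ pair gives
`F(A) = (1 - A)(1 - Ap²) F(Ap³)` (`sum_cubicTerm_sub`, `tsum_cubicTerm_eq_mul`). Iterating, with
`Ap^(3n) → 0`, yields `F(A) = (A;p³)_∞ (Ap²;p³)_∞ F(0)`. The constant `F(0)` is read off at `A =
p⁻¹`, where the series reduces to its first term. The theorem is the case `A = q`. -/

/-! ### Recurrences, bounds and limits of `q`-Pochhammer symbols. -/

theorem qPoch_succ (a q : ℂ) (k : ℕ) : qPoch a q (k + 1) = qPoch a q k * (1 - a * q ^ k) :=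
  Finset.prod_range_succ _ _

theorem qPoch_succ' (a q : ℂ) (k : ℕ) : qPoch a q (k + 1) = (1 - a) * qPoch (a * q) q k := by
  rw [qPoch, Finset.prod_range_succ', mul_comm]
  simp [qPoch, pow_succ', mul_assoc]

theorem tendsto_qPoch (a : ℂ) {q : ℂ} (hq : ‖q‖ < 1) :
    Tendsto (qPoch a q) atTop (𝓝 (qPochInf a q)) :=
  (hasProd_qPochInf a q hq).tendsto_prod_nat

theorem qPoch_mul_qPochInf (a : ℂ) {q : ℂ} (hq : ‖q‖ < 1) (k : ℕ) :
    qPoch a q k * qPochInf (a * q ^ k) q = qPochInf a q := by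
  have h := (hasProd_qPochInf (a * q ^ k) q hq).multipliable
  have := Multipliable.prod_mul_tprod_nat_mul' (f := fun j : ℕ => 1 - a * q ^ j) (k := k)
    (by convert h using 3; ring)
  rw [qPochInf, qPochInf, ← this, qPoch]
  congr 2
  funext j
  ring

theorem qPochInf_eq_mul (a : ℂ) {q : ℂ} (hq : ‖q‖ < 1) :
    qPochInf a q = (1 - a) * qPochInf (a * q) q := by
  simpa [qPoch] using (qPoch_mul_qPochInf a hq 1).symm

theorem qPochInf_ne_zero {a q : ℂ} (hq : ‖q‖ < 1) (h : ∀ j : ℕ, a * q ^ j ≠ 1) :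
    qPochInf a q ≠ 0 := by
  have hs : Summable fun j : ℕ => ‖-(a * q ^ j)‖ := by
    simp only [norm_neg, norm_mul, norm_pow]
    exact (summable_geometric_of_lt_one (norm_nonneg q) hq).mul_left _
  have := tprod_one_add_ne_zero_of_summable (f := fun j : ℕ => -(a * q ^ j))
    (fun j => by rw [← sub_eq_add_neg, sub_ne_zero]; exact (h j).symm) hs
  simpa only [← sub_eq_add_neg, qPochInf] using this

/-- The bound is uniform in `k` and tends to 0 with `a`; it serves both domination and the limit
`(u;q)_∞ → 1` as `u → 0`. -/
theorem norm_qPoch_sub_one_le (a : ℂ) {q : ℂ} (hq : ‖q‖ < 1) (k : ℕ) :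
    ‖qPoch a q k - 1‖ ≤ Real.exp (‖a‖ / (1 - ‖q‖)) - 1 := by
  have h := Finset.norm_prod_one_add_sub_one_le (Finset.range k) (fun j => -(a * q ^ j))
  simp only [← sub_eq_add_neg] at h
  refine h.trans (sub_le_sub_right (Real.exp_le_exp.2 ?_) 1)
  simp only [norm_neg, norm_mul, norm_pow]
  rw [← Finset.mul_sum, div_eq_mul_inv, ← tsum_geometric_of_lt_one (norm_nonneg q) hq]
  gcongr
  exact (summable_geometric_of_lt_one (norm_nonneg q) hq).sum_le_tsum _
    (fun _ _ => by positivity)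

theorem norm_qPochInf_sub_one_le (a : ℂ) {q : ℂ} (hq : ‖q‖ < 1) :
    ‖qPochInf a q - 1‖ ≤ Real.exp (‖a‖ / (1 - ‖q‖)) - 1 :=
  le_of_tendsto ((tendsto_qPoch a hq).sub_const 1).norm
    (Eventually.of_forall fun k => norm_qPoch_sub_one_le a hq k)

theorem norm_qPoch_le {a q : ℂ} (hq : ‖q‖ < 1) {R : ℝ} (ha : ‖a‖ ≤ R) (k : ℕ) :
    ‖qPoch a q k‖ ≤ Real.exp (R / (1 - ‖q‖)) := by
  have h1 := norm_qPoch_sub_one_le a hq k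
  have h2 := norm_sub_norm_le (qPoch a q k) 1
  rw [norm_one] at h2
  have h3 : Real.exp (‖a‖ / (1 - ‖q‖)) ≤ Real.exp (R / (1 - ‖q‖)) := by
    have := sub_pos.2 hq
    gcongr
  linarith

theorem norm_qPochInf_le {a q : ℂ} (hq : ‖q‖ < 1) {R : ℝ} (ha : ‖a‖ ≤ R) :
    ‖qPochInf a q‖ ≤ Real.exp (R / (1 - ‖q‖)) :=
  le_of_tendsto (tendsto_qPoch a hq).norm (Eventually.of_forall fun k => norm_qPoch_le hq ha k)

theorem tendsto_qPochInf_one {q : ℂ} (hq : ‖q‖ < 1) {u : ℕ → ℂ} (hu : Tendsto u atTop (𝓝 0)) :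
    Tendsto (fun n => qPochInf (u n) q) atTop (𝓝 1) := by
  rw [tendsto_iff_norm_sub_tendsto_zero]
  refine squeeze_zero (fun _ => norm_nonneg _) (fun n => norm_qPochInf_sub_one_le (u n) hq) ?_
  have h : Tendsto (fun n => ‖u n‖ / (1 - ‖q‖)) atTop (𝓝 0) := by
    simpa using hu.norm.div_const (1 - ‖q‖)
  simpa using (Real.continuous_exp.tendsto 0 |>.comp h).sub_const 1

theorem qPochInf_zero (q : ℂ) : qPochInf 0 q = 1 := by simp [qPochInf]

theorem pow_ne_one_of_norm_lt_one {p : ℂ} (hp : ‖p‖ < 1) {n : ℕ} (hn : n ≠ 0) : p ^ n ≠ 1 := by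
  intro h
  have := congrArg norm h
  rw [norm_pow, norm_one] at this
  exact (pow_lt_one₀ (norm_nonneg p) hp hn).ne this

theorem qPoch_self_ne_zero {p : ℂ} (hp : ‖p‖ < 1) (k : ℕ) : qPoch p p k ≠ 0 := by
  refine Finset.prod_ne_zero_iff.2 fun j _ => ?_
  rw [← pow_succ', sub_ne_zero]
  exact (pow_ne_one_of_norm_lt_one hp j.succ_ne_zero).symm

theorem exists_norm_inv_qPoch_self_le {p : ℂ} (hp : ‖p‖ < 1) :
    ∃ C : ℝ, 0 ≤ C ∧ ∀ k, ‖(qPoch p p k)⁻¹‖ ≤ C := by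
  have h : qPochInf p p ≠ 0 := qPochInf_ne_zero hp fun j => by
    rw [← pow_succ']
    exact pow_ne_one_of_norm_lt_one hp j.succ_ne_zero
  obtain ⟨C, hC⟩ := ((tendsto_qPoch p hp).inv₀ h).norm.bddAbove_range
  exact ⟨C, (norm_nonneg _).trans (hC ⟨0, rfl⟩), fun k => hC ⟨k, rfl⟩⟩

theorem norm_pow_three_lt_one {p : ℂ} (hp : ‖p‖ < 1) : ‖p ^ 3‖ < 1 := by
  rw [norm_pow]
  exact pow_lt_one₀ (norm_nonneg p) hp three_ne_zero

/-! ### The cubic series and its WZ pair. -/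

/-- The summand of the cubic series with `b * d = p`, multiplied by the infinite products that
clear its denominators in `A`. -/
noncomputable def cubicTerm (p b d A : ℂ) (k : ℕ) : ℂ :=
  (1 - A * p ^ (4 * k)) * (qPoch b p k * qPoch d p k * qPoch A p (2 * k)) *
    (qPoch p p (2 * k))⁻¹ * p ^ (k ^ 2) *
    (qPochInf (A * b * p ^ (3 * k + 2)) (p ^ 3) * qPochInf (A * d * p ^ (3 * k + 2)) (p ^ 3))

/-- The Wilf–Zeilberger companion of `cubicTerm` for the shift `A ↦ A * p ^ 3`. -/
noncomputable def cubicCompanion (p b d A : ℂ) (k : ℕ) : ℂ :=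
  A * p * (1 - A) * qPoch (A * p ^ 2) p (2 * k) * (qPoch b p (k + 1) * qPoch d p (k + 1)) *
    (qPoch p p (2 * k))⁻¹ * p ^ ((k + 1) ^ 2) *
    (qPochInf (A * b * p ^ (3 * k + 5)) (p ^ 3) * qPochInf (A * d * p ^ (3 * k + 5)) (p ^ 3))

/-- Telescoping: each summand with `k ≥ 1` is the difference of companions at `k` and `k - 1`, and
the summand at 0 is the companion at 0, so no boundary term appears. -/
theorem sum_cubicTerm_sub {p b d : ℂ} (hp : ‖p‖ < 1) (hbd : b * d = p) (A : ℂ) (n : ℕ) :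
    ∑ k ∈ Finset.range (n + 1), (cubicTerm p b d A k -
      (1 - A) * (1 - A * p ^ 2) * cubicTerm p b d (A * p ^ 3) k) = cubicCompanion p b d A n := by
  have hp3 := norm_pow_three_lt_one hp
  induction n with
  | zero =>
    have e (y : ℂ) : qPochInf (A * y * p ^ 2) (p ^ 3) =
        (1 - A * y * p ^ 2) * qPochInf (A * y * p ^ 5) (p ^ 3) := by
      rw [qPochInf_eq_mul _ hp3]; ring_nf
    have e' (y : ℂ) : A * p ^ 3 * y * p ^ 2 = A * y * p ^ 5 := by ring
    simp only [Finset.sum_range_one, cubicTerm, cubicCompanion, qPoch, mul_zero, zero_add,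
      Finset.prod_range_zero, Finset.prod_range_one, pow_zero, e, e', mul_one]
    subst hbd
    ring
  | succ k ih =>
    rw [Finset.sum_range_succ, ih]
    have e (y : ℂ) : qPochInf (A * y * p ^ (3 * k + 5)) (p ^ 3) =
        (1 - A * y * p ^ (3 * k + 5)) * qPochInf (A * y * p ^ (3 * k + 8)) (p ^ 3) := by
      rw [qPochInf_eq_mul _ hp3]; ring_nf
    have e' (y : ℂ) : A * p ^ 3 * y * p ^ (3 * k + 5) = A * y * p ^ (3 * k + 8) := by ring
    have hA : qPoch A p (2 * k + 2) = (1 - A) * (1 - A * p) * qPoch (A * p ^ 2) p (2 * k) := by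
      rw [qPoch_succ', qPoch_succ', mul_assoc A, ← sq, mul_assoc (1 - A)]
    have hA2 : qPoch (A * p ^ 2) p (2 * k + 2) = qPoch (A * p ^ 2) p (2 * k) *
        (1 - A * p ^ (2 * k + 2)) * (1 - A * p ^ (2 * k + 3)) := by
      rw [qPoch_succ, qPoch_succ]; ring
    -- The factor `1 - Ap²` completes the shifted symbol to `(Ap²;p)_(2k+3)`, so no division by a
    -- possibly zero factor is needed.
    have hA3 : (1 - A * p ^ 2) * qPoch (A * p ^ 3) p (2 * k + 2) = qPoch (A * p ^ 2) p (2 * k) *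
        (1 - A * p ^ (2 * k + 2)) * (1 - A * p ^ (2 * k + 3)) * (1 - A * p ^ (2 * k + 4)) := by
      have h := qPoch_succ' (A * p ^ 2) p (2 * k + 2)
      rw [qPoch_succ, hA2, mul_assoc A (p ^ 2) p, ← pow_succ] at h
      rw [← h]; ring
    have hP : (qPoch p p (2 * k))⁻¹ = (qPoch p p (2 * k + 2))⁻¹ *
        ((1 - p ^ (2 * k + 1)) * (1 - p ^ (2 * k + 2))) := by
      have h1 := qPoch_self_ne_zero hp (2 * k)
      have h2 := qPoch_self_ne_zero hp (2 * k + 2)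
      have h : qPoch p p (2 * k + 2) = qPoch p p (2 * k) *
        ((1 - p ^ (2 * k + 1)) * (1 - p ^ (2 * k + 2))) := by
        rw [qPoch_succ, qPoch_succ]; ring
      field_simp
      linear_combination h
    have i1 : 3 * (k + 1) + 2 = 3 * k + 5 := by ring
    have i2 : 3 * (k + 1) + 5 = 3 * k + 8 := by ring
    have i3 : 2 * (k + 1) = 2 * k + 2 := by ring
    have hb : qPoch b p (k + 2) = qPoch b p (k + 1) * (1 - b * p ^ (k + 1)) := qPoch_succ _ _ _
    have hd : qPoch d p (k + 2) = qPoch d p (k + 1) * (1 - d * p ^ (k + 1)) := qPoch_succ _ _ _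
    have hsq : p ^ ((k + 1 + 1) ^ 2) = p ^ ((k + 1) ^ 2) * (p ^ k) ^ 2 * p ^ 3 := by ring
    simp only [cubicTerm, cubicCompanion, i1, i2, i3, e, e', hA, hA2, hP, hsq]
    rw [show k + 1 + 1 = k + 2 from rfl, hb, hd]
    generalize qPochInf (A * b * p ^ (3 * k + 8)) (p ^ 3) = Q₁
    generalize qPochInf (A * d * p ^ (3 * k + 8)) (p ^ 3) = Q₂
    generalize qPoch b p (k + 1) = B
    generalize qPoch d p (k + 1) = D
    generalize (qPoch p p (2 * k + 2))⁻¹ = P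
    generalize p ^ ((k + 1) ^ 2) = S
    have key : (1 - A * p ^ 2) * ((1 - A * p ^ 3 * p ^ (4 * (k + 1))) *
        (B * D * qPoch (A * p ^ 3) p (2 * k + 2)) * P * S * (Q₁ * Q₂)) =
        (1 - A * p ^ 3 * p ^ (4 * (k + 1))) * (B * D * (qPoch (A * p ^ 2) p (2 * k) *
        (1 - A * p ^ (2 * k + 2)) * (1 - A * p ^ (2 * k + 3)) * (1 - A * p ^ (2 * k + 4)))) *
        P * S * (Q₁ * Q₂) := by
      rw [← hA3]; ring
    rw [mul_assoc (1 - A) (1 - A * p ^ 2), key]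
    generalize qPoch (A * p ^ 2) p (2 * k) = H
    simp only [pow_add, pow_mul', mul_add, mul_one]
    -- What remains is a polynomial identity in `A`, `b`, `d` and `x = p^k`, valid because `p = bd`.
    generalize p ^ k = x
    subst hbd
    ring

/-! ### Convergence, the functional equation and its solution. -/

/-- Uniformity over `‖A‖ ≤ R` is what lets dominated convergence take `A * p^(3n)` to 0 inside the
sum. -/
theorem exists_norm_cubicTerm_le {p : ℂ} (hp : ‖p‖ < 1) (b d : ℂ) (R : ℝ) :
    ∃ C : ℝ, ∀ A : ℂ, ‖A‖ ≤ R → ∀ k, ‖cubicTerm p b d A k‖ ≤ C * ‖p‖ ^ k := by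
  obtain ⟨C, hC0, hC⟩ := exists_norm_inv_qPoch_self_le hp
  have hp3 := norm_pow_three_lt_one hp
  refine ⟨(1 + R) * (Real.exp (‖b‖ / (1 - ‖p‖)) * Real.exp (‖d‖ / (1 - ‖p‖)) *
    Real.exp (R / (1 - ‖p‖))) * C * (Real.exp (R * ‖b‖ / (1 - ‖p ^ 3‖)) *
    Real.exp (R * ‖d‖ / (1 - ‖p ^ 3‖))), fun A hA k => ?_⟩
  have hR : 0 ≤ R := (norm_nonneg A).trans hA
  have hpow (n : ℕ) : ‖p‖ ^ n ≤ 1 := pow_le_one₀ (norm_nonneg p) hp.le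
  have h1 : ‖1 - A * p ^ (4 * k)‖ ≤ 1 + R := by
    refine (norm_sub_le _ _).trans ?_
    rw [norm_one, norm_mul, norm_pow]
    have := mul_le_mul hA (hpow (4 * k)) (by positivity) hR
    linarith
  have h2 (y : ℂ) : ‖qPochInf (A * y * p ^ (3 * k + 2)) (p ^ 3)‖ ≤
      Real.exp (R * ‖y‖ / (1 - ‖p ^ 3‖)) := by
    refine norm_qPochInf_le hp3 ?_
    rw [norm_mul, norm_mul, norm_pow]
    have := mul_le_mul (mul_le_mul_of_nonneg_right hA (norm_nonneg y)) (hpow (3 * k + 2))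
      (by positivity) (by positivity)
    linarith
  have h3 : ‖p‖ ^ (k ^ 2) ≤ ‖p‖ ^ k :=
    pow_le_pow_of_le_one (norm_nonneg p) hp.le (Nat.le_self_pow two_ne_zero k)
  calc ‖cubicTerm p b d A k‖ ≤ (1 + R) * (Real.exp (‖b‖ / (1 - ‖p‖)) *
      Real.exp (‖d‖ / (1 - ‖p‖)) * Real.exp (R / (1 - ‖p‖))) * C * ‖p‖ ^ k *
      (Real.exp (R * ‖b‖ / (1 - ‖p ^ 3‖)) * Real.exp (R * ‖d‖ / (1 - ‖p ^ 3‖))) := by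
        rw [cubicTerm]
        simp only [norm_mul]
        rw [norm_pow p (k ^ 2)]
        gcongr
        exacts [norm_qPoch_le hp le_rfl k, norm_qPoch_le hp le_rfl k, norm_qPoch_le hp hA _,
          hC _, h2 b, h2 d]
    _ = _ := by ring

theorem summable_norm_cubicTerm {p : ℂ} (hp : ‖p‖ < 1) (b d A : ℂ) :
    Summable fun k => ‖cubicTerm p b d A k‖ := by
  obtain ⟨C, hC⟩ := exists_norm_cubicTerm_le hp b d ‖A‖
  exact Summable.of_nonneg_of_le (fun _ => norm_nonneg _) (hC A le_rfl)
    ((summable_geometric_of_lt_one (norm_nonneg p) hp).mul_left C)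

theorem tendsto_cubicCompanion {p : ℂ} (hp : ‖p‖ < 1) (b d A : ℂ) :
    Tendsto (cubicCompanion p b d A) atTop (𝓝 0) := by
  have hp3 := norm_pow_three_lt_one hp
  have hP : qPochInf p p ≠ 0 := qPochInf_ne_zero hp fun j => by
    rw [← pow_succ']
    exact pow_ne_one_of_norm_lt_one hp j.succ_ne_zero
  have h0 := tendsto_pow_atTop_nhds_zero_of_norm_lt_one hp
  have h2 : Tendsto (fun k : ℕ => 2 * k) atTop atTop :=
    tendsto_id.const_mul_atTop' two_pos
  have h1 : Tendsto (fun k : ℕ => k + 1) atTop atTop := tendsto_add_atTop_nat 1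
  have hsq : Tendsto (fun k : ℕ => (k + 1) ^ 2) atTop atTop :=
    (tendsto_pow_atTop two_ne_zero).comp h1
  have h5 : Tendsto (fun k : ℕ => 3 * k + 5) atTop atTop :=
    (tendsto_add_atTop_nat 5).comp (tendsto_id.const_mul_atTop' three_pos)
  have hQ (y : ℂ) : Tendsto (fun k : ℕ => qPochInf (A * y * p ^ (3 * k + 5)) (p ^ 3)) atTop
      (𝓝 1) :=
    tendsto_qPochInf_one hp3 (by simpa using (h0.comp h5).const_mul (A * y))
  have := ((((((tendsto_qPoch (A * p ^ 2) hp).comp h2).const_mul (A * p * (1 - A))).mul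
    (((tendsto_qPoch b hp).comp h1).mul ((tendsto_qPoch d hp).comp h1))).mul
    (((tendsto_qPoch p hp).comp h2).inv₀ hP)).mul (h0.comp hsq)).mul ((hQ b).mul (hQ d))
  simp only [mul_zero, zero_mul] at this
  exact this

theorem tsum_cubicTerm_eq_mul {p b d : ℂ} (hp : ‖p‖ < 1) (hbd : b * d = p) (A : ℂ) :
    ∑' k, cubicTerm p b d A k =
      (1 - A) * (1 - A * p ^ 2) * ∑' k, cubicTerm p b d (A * p ^ 3) k := by
  have h1 := (summable_norm_cubicTerm hp b d A).of_norm.hasSum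
  have h2 := (summable_norm_cubicTerm hp b d (A * p ^ 3)).of_norm.hasSum
  have h3 := (h1.sub (h2.mul_left ((1 - A) * (1 - A * p ^ 2)))).tendsto_sum_nat.comp
    (tendsto_add_atTop_nat 1)
  have h4 : Tendsto (cubicCompanion p b d A) atTop _ :=
    h3.congr fun n => sum_cubicTerm_sub hp hbd A n
  exact sub_eq_zero.1 (tendsto_nhds_unique h4 (tendsto_cubicCompanion hp b d A))

theorem tsum_cubicTerm_eq_qPoch_mul {p b d : ℂ} (hp : ‖p‖ < 1) (hbd : b * d = p) (A : ℂ) (n : ℕ) :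
    ∑' k, cubicTerm p b d A k = qPoch A (p ^ 3) n * qPoch (A * p ^ 2) (p ^ 3) n *
      ∑' k, cubicTerm p b d (A * (p ^ 3) ^ n) k := by
  induction n with
  | zero => simp [qPoch]
  | succ n ih =>
    rw [ih, tsum_cubicTerm_eq_mul hp hbd, qPoch_succ, qPoch_succ, pow_succ (p ^ 3), ← mul_assoc A]
    ring

theorem tendsto_tsum_cubicTerm {p : ℂ} (hp : ‖p‖ < 1) (b d A : ℂ) :
    Tendsto (fun n : ℕ => ∑' k, cubicTerm p b d (A * (p ^ 3) ^ n) k) atTop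
      (𝓝 (∑' k, cubicTerm p b d 0 k)) := by
  have hp3 := norm_pow_three_lt_one hp
  obtain ⟨C, hC⟩ := exists_norm_cubicTerm_le hp b d ‖A‖
  have hA : Tendsto (fun n : ℕ => A * (p ^ 3) ^ n) atTop (𝓝 0) := by
    simpa using (tendsto_pow_atTop_nhds_zero_of_norm_lt_one hp3).const_mul A
  refine tendsto_tsum_of_dominated_convergence
    ((summable_geometric_of_lt_one (norm_nonneg p) hp).mul_left C) (fun k => ?_)
    (Eventually.of_forall fun n k => hC _ ?_ k)
  · have hpoch : Tendsto (fun n : ℕ => qPoch (A * (p ^ 3) ^ n) p (2 * k)) atTop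
        (𝓝 (qPoch 0 p (2 * k))) :=
      tendsto_finsetProd _ fun j _ => (hA.mul_const (p ^ j)).const_sub 1
    have hQ (y : ℂ) : Tendsto (fun n : ℕ =>
        qPochInf (A * (p ^ 3) ^ n * y * p ^ (3 * k + 2)) (p ^ 3)) atTop
        (𝓝 (qPochInf (0 * y * p ^ (3 * k + 2)) (p ^ 3))) := by
      rw [zero_mul, zero_mul, qPochInf_zero]
      exact tendsto_qPochInf_one hp3 (by simpa using (hA.mul_const y).mul_const (p ^ (3 * k + 2)))
    exact ((((((hA.mul_const (p ^ (4 * k))).const_sub 1).mul (hpoch.const_mul _)).mul_const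
      _).mul_const _).mul ((hQ b).mul (hQ d)))
  · rw [norm_mul, norm_pow]
    exact mul_le_of_le_one_right (norm_nonneg A) (pow_le_one₀ (norm_nonneg _) hp3.le)

theorem tsum_cubicTerm_eq_qPochInf_mul {p b d : ℂ} (hp : ‖p‖ < 1) (hbd : b * d = p) (A : ℂ) :
    ∑' k, cubicTerm p b d A k = qPochInf A (p ^ 3) * qPochInf (A * p ^ 2) (p ^ 3) *
      ∑' k, cubicTerm p b d 0 k := by
  have hp3 := norm_pow_three_lt_one hp
  exact tendsto_nhds_unique
    (tendsto_const_nhds.congr fun n => tsum_cubicTerm_eq_qPoch_mul hp hbd A n)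
    (((tendsto_qPoch A hp3).mul (tendsto_qPoch (A * p ^ 2) hp3)).mul
      (tendsto_tsum_cubicTerm hp b d A))

/-- For `k ≥ 1` the symbol `(p⁻¹;p)_(2k)` contains the factor `1 - p⁻¹ p = 0`. -/
theorem tsum_cubicTerm_inv {p : ℂ} (hp0 : p ≠ 0) (b d : ℂ) :
    ∑' k, cubicTerm p b d p⁻¹ k =
      (1 - p⁻¹) * (qPochInf (b * p) (p ^ 3) * qPochInf (d * p) (p ^ 3)) := by
  rw [tsum_eq_single 0]
  · have e (y : ℂ) : p⁻¹ * y * p ^ 2 = y * p := by field_simp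
    simp [cubicTerm, qPoch, e]
  · intro k hk
    have : qPoch p⁻¹ p (2 * k) = 0 :=
      Finset.prod_eq_zero (Finset.mem_range.2 (by omega : 1 < 2 * k)) (by simp [hp0])
    simp [cubicTerm, this]

/-- The `A = 0` case of the cubic summation. -/
theorem tsum_cubicTerm_zero {p b d : ℂ} (hp0 : p ≠ 0) (hp : ‖p‖ < 1) (hbd : b * d = p) :
    qPochInf p (p ^ 3) * qPochInf (p ^ 2) (p ^ 3) * ∑' k, cubicTerm p b d 0 k =
      qPochInf (b * p) (p ^ 3) * qPochInf (d * p) (p ^ 3) := by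
  have hp3 := norm_pow_three_lt_one hp
  have h := tsum_cubicTerm_eq_qPochInf_mul hp hbd p⁻¹
  have e1 : p⁻¹ * p ^ 3 = p ^ 2 := by field_simp
  have e2 : p⁻¹ * p ^ 2 = p := by field_simp
  rw [tsum_cubicTerm_inv hp0, qPochInf_eq_mul p⁻¹ hp3, e1, e2, mul_assoc, mul_assoc] at h
  -- This factor is common to both sides: on the left it comes from `(p⁻¹;p³)_∞ = (1 -
  -- p⁻¹)(p²;p³)_∞`.
  have h1 : 1 - p⁻¹ ≠ 0 := by
    rw [sub_ne_zero, ne_comm, Ne, inv_eq_one]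
    simpa using pow_ne_one_of_norm_lt_one hp one_ne_zero
  rw [mul_left_cancel₀ h1 h]
  ring

/-- The cubic summation formula, cleared of denominators. -/
theorem hasSum_cubicTerm {p b d : ℂ} (hp0 : p ≠ 0) (hp : ‖p‖ < 1) (hbd : b * d = p) (A : ℂ) :
    HasSum (cubicTerm p b d A)
      (qPochInf A (p ^ 3) * qPochInf (A * p ^ 2) (p ^ 3) *
        (qPochInf (b * p) (p ^ 3) * qPochInf (d * p) (p ^ 3)) /
        (qPochInf p (p ^ 3) * qPochInf (p ^ 2) (p ^ 3))) := by
  have hp3 := norm_pow_three_lt_one hp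
  have hne (m : ℕ) (hm : m ≠ 0) : qPochInf (p ^ m) (p ^ 3) ≠ 0 := qPochInf_ne_zero hp3 fun j => by
    rw [← pow_mul, ← pow_add]
    exact pow_ne_one_of_norm_lt_one hp (by omega)
  have h1 : qPochInf p (p ^ 3) ≠ 0 := by simpa using hne 1 one_ne_zero
  have h2 := hne 2 two_ne_zero
  refine (congrArg (HasSum _) ?_).mp (summable_norm_cubicTerm hp b d A).of_norm.hasSum
  rw [tsum_cubicTerm_eq_qPochInf_mul hp hbd A, ← tsum_cubicTerm_zero hp0 hp hbd]
  field_simp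

/-! ### Specialization to the stated series. -/

/-- Here `A b p^(3k+2) = a q^(6k+6)`, so the clearing product is the tail `(aq^6;q^6)_∞ /
(aq^6;q^6)_k`; likewise for `d`. -/
theorem cubicTerm_eq_mul_div {q a : ℂ} (hq : ‖q‖ < 1)
    (h₁ : qPochInf (a * q ^ 6) (q ^ 6) ≠ 0) (h₂ : qPochInf (q ^ 6 / a) (q ^ 6) ≠ 0) (k : ℕ) :
    cubicTerm (q ^ 2) (a * q) (q / a) q k =
      (1 - q) * (qPochInf (a * q ^ 6) (q ^ 6) * qPochInf (q ^ 6 / a) (q ^ 6)) *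
      ((qPoch (a * q) (q ^ 2) k * qPoch (q / a) (q ^ 2) k * qPoch q (q ^ 2) (2 * k)) /
          (qPoch (q ^ 2) (q ^ 2) (2 * k) * qPoch (a * q ^ 6) (q ^ 6) k *
            qPoch (q ^ 6 / a) (q ^ 6) k) *
          qNumber q (8 * k + 1) * q ^ (2 * k ^ 2)) := by
  have hq6 : ‖q ^ 6‖ < 1 := by
    rw [norm_pow]
    exact pow_lt_one₀ (norm_nonneg q) hq (by norm_num)
  have hq1 : 1 - q ≠ 0 := sub_ne_zero.2 fun h => by simp [← h] at hq
  have e1 : q * (a * q) * (q ^ 2) ^ (3 * k + 2) = a * q ^ 6 * (q ^ 6) ^ k := by ring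
  have e2 : q * (q / a) * (q ^ 2) ^ (3 * k + 2) = q ^ 6 / a * (q ^ 6) ^ k := by ring
  have s1 := qPoch_mul_qPochInf (a * q ^ 6) hq6 k
  have s2 := qPoch_mul_qPochInf (q ^ 6 / a) hq6 k
  have e3 : (q ^ 2) ^ 3 = q ^ 6 := by ring
  rw [cubicTerm, qNumber, e1, e2, e3, ← pow_mul q 2 (4 * k), ← pow_mul q 2 (k ^ 2), ← s1, ← s2]
  rw [← s1] at h₁
  rw [← s2] at h₂
  have n1 := left_ne_zero_of_mul h₁
  have n2 := left_ne_zero_of_mul h₂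
  generalize qPochInf (a * q ^ 6 * (q ^ 6) ^ k) (q ^ 6) = Q₁
  generalize qPochInf (q ^ 6 / a * (q ^ 6) ^ k) (q ^ 6) = Q₂
  generalize qPoch (a * q ^ 6) (q ^ 6) k = P₁ at *
  generalize qPoch (q ^ 6 / a) (q ^ 6) k = P₂ at *
  rw [show 2 * (4 * k) = 8 * k by ring, pow_succ' q (8 * k)]
  field_simp

/-- In `ℂ`, the unconditional convergence expressed by `HasSum` is absolute convergence. -/
theorem theorem6 (q a : ℂ) (hq : ‖q‖ < 1) (ha : a ≠ 0)
    (ha₁ : ∀ j : ℕ, 1 ≤ j → a * q ^ (6 * j) ≠ 1)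
    (ha₂ : ∀ j : ℕ, 1 ≤ j → q ^ (6 * j) / a ≠ 1) :
    HasSum
      (fun k : ℕ =>
        (qPoch (a * q) (q ^ 2) k * qPoch (q / a) (q ^ 2) k * qPoch q (q ^ 2) (2 * k)) /
          (qPoch (q ^ 2) (q ^ 2) (2 * k) * qPoch (a * q ^ 6) (q ^ 6) k *
            qPoch (q ^ 6 / a) (q ^ 6) k) *
          qNumber q (8 * k + 1) * q ^ (2 * k ^ 2))
      ((qPochInf (q ^ 5) (q ^ 6) * qPochInf (q ^ 7) (q ^ 6) *
          qPochInf (a * q ^ 3) (q ^ 6) * qPochInf (q ^ 3 / a) (q ^ 6)) /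
        (qPochInf (q ^ 2) (q ^ 6) * qPochInf (q ^ 4) (q ^ 6) *
          qPochInf (a * q ^ 6) (q ^ 6) * qPochInf (q ^ 6 / a) (q ^ 6))) := by
  -- The evaluation at `A = p⁻¹` needs `q ≠ 0`; for `q = 0` only the term `k = 0` survives.
  rcases eq_or_ne q 0 with rfl | hq0
  · convert hasSum_single (f := _) 0 ?_ using 1
    · simp [qPochInf, qPoch, qNumber]
    · intro k hk
      simp [hk]
  have hq6 : ‖q ^ 6‖ < 1 := by
    rw [norm_pow]
    exact pow_lt_one₀ (norm_nonneg q) hq (by norm_num)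
  have hq2 : ‖q ^ 2‖ < 1 := by
    rw [norm_pow]
    exact pow_lt_one₀ (norm_nonneg q) hq two_ne_zero
  have hq1 : 1 - q ≠ 0 := sub_ne_zero.2 fun h => by simp [← h] at hq
  have h₁ : qPochInf (a * q ^ 6) (q ^ 6) ≠ 0 := qPochInf_ne_zero hq6 fun j => by
    convert ha₁ (j + 1) (by omega) using 1; ring
  have h₂ : qPochInf (q ^ 6 / a) (q ^ 6) ≠ 0 := qPochInf_ne_zero hq6 fun j => by
    convert ha₂ (j + 1) (by omega) using 1; ring
  have hbd : a * q * (q / a) = q ^ 2 := by field_simp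
  have h := (hasSum_cubicTerm (pow_ne_zero 2 hq0) hq2 hbd q).div_const
    ((1 - q) * (qPochInf (a * q ^ 6) (q ^ 6) * qPochInf (q ^ 6 / a) (q ^ 6)))
  have hc := mul_ne_zero hq1 (mul_ne_zero h₁ h₂)
  simp only [cubicTerm_eq_mul_div hq h₁ h₂, mul_div_cancel_left₀ _ hc] at h
  refine (congrArg (HasSum _) ?_).mp h
  have e1 : q * (q ^ 2) ^ 2 = q ^ 5 := by ring
  have e2 : a * q * q ^ 2 = a * q ^ 3 := by ring
  have e3 : q / a * q ^ 2 = q ^ 3 / a := by ring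
  have e4 : q * q ^ 6 = q ^ 7 := by ring
  have hne (m : ℕ) (hm : m ≠ 0) : qPochInf (q ^ m) (q ^ 6) ≠ 0 := qPochInf_ne_zero hq6 fun j => by
    rw [← pow_mul, ← pow_add]
    exact pow_ne_one_of_norm_lt_one hq (by omega)
  have n2 := hne 2 (by norm_num)
  have n4 := hne 4 (by norm_num)
  simp only [← pow_mul, Nat.reduceMul] at e1 ⊢
  -- Splitting `1 - q` off `(q;q^6)_∞` leaves `(q^7;q^6)_∞` and cancels the `1 - q` coming from
  -- `[8k+1]`.
  rw [e1, e2, e3, qPochInf_eq_mul q hq6, e4]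
  field_simp
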